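/- \textbf{Setting.} Let $(\mathcal G,\preceq)$ be a finite partially ordered set of items, where $G\preceq K$ means that $K$ is at least as good as $G$, and let $N^+(G)$ be the set of items that cover $G$ (the immediately better items). A single buyer has a type $(v,G)$ with value $v\in[0,H]$ and interest $G\in\mathcal G$, and receives value $v$ from any item $K\succeq G$ and value $0$ from any other item. Types are drawn from a probability distribution on $[0,H]\times\mathcal G$ with density $f_G(v)$. Put $F_G(v)=\int_0^v f_G(w)\,dw$, $q_G=F_G(H)$ and $R_G(v)=v\,(q_G-F_G(v))$ (that is, $q_G$ times $v(1-F(v))$, where $F$ is the distribution function of the value given interest $G$). Item $G$ satisfies declining marginal revenue (DMR) if $R_G$ is concave on $[0,H]$. A direct mechanism assigns to each report $(v,G)$ a lottery over the items and "no item", together with an expected payment; it is admissible if truth-telling is optimal for every type and gives every type nonnegative expected utility. It is optimal if it is admissible and its expected revenue is at least that of every admissible mechanism. An item-pricing mechanism with prices $(p_G)$ lets every type choose a utility-maximizing option among buying one item $K$ at price $p_K$ and buying nothing. \textbf{Theorem.} Suppose that every item satisfies DMR. Then there are prices $p_G\in[0,H]$, $G\in\mathcal G$, for which the deterministic item-pricing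 mechanism is optimal (among all, also randomized, admissible mechanisms), however ties are broken. Moreover, the prices can be obtained as follows. There are integrable functions $\alpha_{G,G'}\ge 0$ on $[0,H]$, for $G\in\mathcal G$ and $G'\in N^+(G)$, and for every $G$ a monopoly price $r_G$ of the adjusted revenue curve $$R^{\alpha}_G(v)=R_G(v)+\int_0^v\Big(\sum_{G':\,G\in N^+(G')}\int_w^H\alpha_{G',G}(x)\,dx-\sum_{G'\in N^+(G)}\int_w^H\alpha_{G,G'}(x)\,dx\Big)dw,$$ i.e. a maximizer of $R^\alpha_G$ on $[0,H]$, such that, processing the items from the best ones downwards, $$p_G=r_G\ \text{ if } N^+(G)=\emptyset,\qquad p_G=\min\Big\{r_G,\ \min_{G'\in N^+(G)}p_{G'}\Big\}\ \text{ otherwise};$$ each $p_G$ is itself a maximizer of $R_G^\alpha$ on $[0,H]$, and $\alpha_{G,G'}(v)>0$ only if types $(v,G)$ and $(v,G')$ get the same utility, i.e. $\max\{v-p_G,0\}=\max\{v-p_{G'},0\}$. -/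

import Mathlib

open Set MeasureTheory
open scoped BigOperators

/-!
A single buyer has a type `(v, G)`: a value `v ∈ [0, H]` and an interest `G` in a finite partially
ordered set `ι` of items.  `G ≤ K` means that `K` is at least as good as `G`; the buyer gets value
`v` from any item `K` with `G ≤ K`, and value `0` from any other item.
-/

noncomputable section

namespace POPricing

variable {ι : Type*}

/-- `f G v` is the density at `(v, G)` of a probability distribution on `[0, H] × ι`. -/
structure IsTypeDensity [Fintype ι] (H : ℝ) (f : ι → ℝ → ℝ) : Prop where
  nonneg : ∀ G, ∀ v ∈ Icc (0 : ℝ) H, 0 ≤ f G v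
  integrable : ∀ G, IntegrableOn (f G) (Icc (0 : ℝ) H)
  total : ∑ G, ∫ v in Icc (0 : ℝ) H, f G v = 1

/-- The mass of the types with interest `G` and value at most `v`. -/
def massBelow (f : ι → ℝ → ℝ) (G : ι) (v : ℝ) : ℝ := ∫ w in (0 : ℝ)..v, f G w

/-- The revenue curve `R_G(v) = v (q_G - F_G(v))`, where `q_G = F_G(H)` is the probability of
interest `G`; equivalently `q_G` times `v (1 - F(v))` for the conditional distribution function
`F = F_G / q_G` of the value given interest `G`. -/
def revenueCurve (H : ℝ) (f : ι → ℝ → ℝ) (G : ι) (v : ℝ) : ℝ :=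
  v * (massBelow f G H - massBelow f G v)

/-- Declining marginal revenues of item `G`: the revenue curve is concave on `[0, H]`. -/
def DMR (H : ℝ) (f : ι → ℝ → ℝ) (G : ι) : Prop :=
  ConcaveOn ℝ (Icc (0 : ℝ) H) (revenueCurve H f G)

/-- A direct mechanism.  On report `(v, G)`, item `K` is awarded with probability `alloc v G K`
(and no item with the remaining probability), and the expected payment is `pay v G`. -/
structure Mechanism (ι : Type*) where
  alloc : ℝ → ι → ι → ℝ
  pay : ℝ → ι → ℝ

open Classical in
/-- Expected utility of type `(v, G)` when reporting `(v', G')`. -/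
def Mechanism.utility [Fintype ι] [PartialOrder ι] (M : Mechanism ι)
    (v : ℝ) (G : ι) (v' : ℝ) (G' : ι) : ℝ :=
  v * (∑ K with G ≤ K, M.alloc v' G' K) - M.pay v' G'

/-- Allocation probabilities are lotteries over the items and "no item", truth-telling is optimal
for every type, and truthful participation gives nonnegative utility. -/
structure Mechanism.IsAdmissible [Fintype ι] [PartialOrder ι] (H : ℝ) (M : Mechanism ι) :
    Prop where
  alloc_nonneg : ∀ v ∈ Icc (0 : ℝ) H, ∀ G K, 0 ≤ M.alloc v G K
  alloc_sum_le_one : ∀ v ∈ Icc (0 : ℝ) H, ∀ G, ∑ K, M.alloc v G K ≤ 1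
  incentive_compatible : ∀ v ∈ Icc (0 : ℝ) H, ∀ G, ∀ v' ∈ Icc (0 : ℝ) H, ∀ G',
    M.utility v G v' G' ≤ M.utility v G v G
  individually_rational : ∀ v ∈ Icc (0 : ℝ) H, ∀ G, 0 ≤ M.utility v G v G

/-- Expected revenue under truthful reports.  The payment rule of an admissible mechanism is
monotone in the value on `[0, H]`, so that the integrals exist. -/
def Mechanism.revenue [Fintype ι] (H : ℝ) (f : ι → ℝ → ℝ) (M : Mechanism ι) : ℝ :=
  ∑ G, ∫ v in Icc (0 : ℝ) H, f G v * M.pay v G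

/-- `M` is admissible and earns at least as much as every admissible, possibly randomized,
mechanism. -/
def Mechanism.IsOptimal [Fintype ι] [PartialOrder ι] (H : ℝ) (f : ι → ℝ → ℝ)
    (M : Mechanism ι) : Prop :=
  M.IsAdmissible H ∧ ∀ M' : Mechanism ι, M'.IsAdmissible H → M'.revenue H f ≤ M.revenue H f

open Classical in
/-- Utility of type `(v, G)` facing item prices `p`, from buying nothing (`none`) or item `K`
(`some K`). -/
def purchaseUtility [PartialOrder ι] (p : ι → ℝ) (v : ℝ) (G : ι) : Option ι → ℝ
  | none => 0
  | some K => (if G ≤ K then v else 0) - p K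

open Classical in
/-- `M` is the deterministic mechanism that posts the take-it-or-leave-it price `p K` for each item
`K`: every type obtains, with certainty, a utility-maximizing choice among buying one item at its
price and buying nothing. -/
def Mechanism.IsItemPricing [PartialOrder ι] (H : ℝ) (p : ι → ℝ) (M : Mechanism ι) : Prop :=
  ∀ v ∈ Icc (0 : ℝ) H, ∀ G, ∃ c : Option ι,
    (∀ c' : Option ι, purchaseUtility p v G c' ≤ purchaseUtility p v G c) ∧
    (∀ K, M.alloc v G K = if c = some K then 1 else 0) ∧
    M.pay v G = c.elim 0 p

/-- A family of dual variables `α_{G,G'} ≥ 0` on `[0, H]`, one for each pair in which `G'` is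
immediately better than `G`. -/
def IsFlow [PartialOrder ι] (H : ℝ) (α : ι → ι → ℝ → ℝ) : Prop :=
  ∀ G G', G ⋖ G' →
    IntervalIntegrable (α G G') volume 0 H ∧ ∀ v ∈ Icc (0 : ℝ) H, 0 ≤ α G G' v

open Classical in
/-- The revenue curve of `G` after sending the flow `α`.  Its derivative at `v` is
`R_G'(v)`, plus the flow into `G` on `[v, H]`, minus the flow out of `G` on `[v, H]`, which is
minus the flow-adjusted virtual value of `G` at `v` times the density. -/
def adjustedCurve [Fintype ι] [PartialOrder ι] (H : ℝ) (f : ι → ℝ → ℝ) (α : ι → ι → ℝ → ℝ)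
    (G : ι) (v : ℝ) : ℝ :=
  revenueCurve H f G v +
    ∫ w in (0 : ℝ)..v,
      ((∑ G' with G' ⋖ G, ∫ x in w..H, α G' G x) - ∑ G' with G ⋖ G', ∫ x in w..H, α G G' x)

/-- `r` is a monopoly price of the curve `R` on `[0, H]`. -/
def IsMonopolyPrice (H : ℝ) (R : ℝ → ℝ) (r : ℝ) : Prop :=
  r ∈ Icc (0 : ℝ) H ∧ ∀ v ∈ Icc (0 : ℝ) H, R v ≤ R r

/-- Prices built from reserve prices `r`, starting at the best items: `p G` is the least of `r G`
and of the prices of the items that are immediately better than `G` (so `p G = r G` if there are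
none). -/
def IsRecursivePrice [PartialOrder ι] (r p : ι → ℝ) : Prop :=
  ∀ G, IsLeast (insert (r G) (p '' {G' | G ⋖ G'})) (p G)

end POPricing

end

/-! Restricted to prices, the problem is a concave program. Monotone prices `p` earn `∑ R_G(p_G)`,
since no item acceptable to interest `G` is then cheaper than `G` itself
(`Mechanism.IsItemPricing.revenue_eq`). Under DMR this sum is concave, and strictly increasing
prices are a Slater point, so covering pairs carry Lagrange multipliers `l` (`exists_multipliers`).
With `Λ_G` the net inflow of `l` at `G`, an optimal `p_G` maximizes `R_G(v) + Λ_G v`, and `l`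
vanishes on pairs with different prices.

The same multipliers bound all lotteries. In an admissible mechanism the probability `x_G` of being
served is almost everywhere the derivative of the utility `u_G`, so `q_G = H - (u_G(H) - u_G(0))` is
the integral of `1 - x_G`, an average price. Integration by parts and concavity bound the revenue
from `G` by `R_G(p_G) + Λ_G (p_G - q_G)` (`IsUtilityCurve.revenue_le`). As `u_G(0)` does not depend
on `G` and `u_G(H)` weakly decreases in `G`, the `q_G` are monotone; with complementary slackness
the `Λ` terms sum to at most `0`.

For the flow, each multiplier is spread uniformly over `[m, H]`, where `m < H` bounds all prices and
all `R_G` decrease beyond `m`. Up to `m` the adjusted curve is `R_G(v) + Λ_G v`, and beyond `m`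
nothing better arises, so `r = p` works. -/

noncomputable section

namespace POPricing

variable {ι : Type*}

/-! ### Regularity of revenue curves. -/

section Curves

variable {H : ℝ} {f : ι → ℝ → ℝ} {G : ι}

theorem IsTypeDensity.intervalIntegrable [Fintype ι] (hf : IsTypeDensity H f) (hH : 0 ≤ H)
    (G : ι) : IntervalIntegrable (f G) volume 0 H :=
  (intervalIntegrable_iff_integrableOn_Icc_of_le hH).2 (hf.integrable G)

theorem IsTypeDensity.pos [Fintype ι] (hf : IsTypeDensity H f) : 0 < H := by
  by_contra! h
  have h0 : volume (Icc (0 : ℝ) H) = 0 := by simp [h]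
  have := hf.total
  simp [Measure.restrict_eq_zero.2 h0] at this

/-- The mass of the types with interest `G` and value at least `v`. -/
def massAbove (H : ℝ) (f : ι → ℝ → ℝ) (G : ι) (v : ℝ) : ℝ := massBelow f G H - massBelow f G v

theorem revenueCurve_eq (v : ℝ) : revenueCurve H f G v = v * massAbove H f G v := rfl

theorem massAbove_right : massAbove H f G H = 0 := sub_self _

theorem massAbove_eq_integral (hH : 0 ≤ H) (hf : IntervalIntegrable (f G) volume 0 H) {v : ℝ}
    (hv : v ∈ Icc 0 H) : massAbove H f G v = ∫ w in v..H, f G w := by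
  rw [massAbove, massBelow, massBelow, intervalIntegral.integral_interval_sub_left hf]
  exact hf.mono_set (by grind [uIcc_of_le])

theorem massAbove_nonneg (hf0 : ∀ v ∈ Icc (0 : ℝ) H, 0 ≤ f G v)
    (hf : IntervalIntegrable (f G) volume 0 H) {v : ℝ} (hv : v ∈ Icc 0 H) :
    0 ≤ massAbove H f G v := by
  rw [massAbove_eq_integral (hv.1.trans hv.2) hf hv]
  exact intervalIntegral.integral_nonneg hv.2 fun w hw => hf0 w ⟨hv.1.trans hw.1, hw.2⟩

theorem absolutelyContinuous_massAbove (hf : IntervalIntegrable (f G) volume 0 H) :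
    AbsolutelyContinuousOnInterval (massAbove H f G) 0 H := by
  have h := (hf.absolutelyContinuousOnInterval_intervalIntegral (c := 0) (by simp))
  have hc : AbsolutelyContinuousOnInterval (fun _ : ℝ => massBelow f G H) 0 H :=
    (contDiff_const.contDiffOn).absolutelyContinuousOnInterval
  exact hc.sub h

theorem absolutelyContinuous_revenueCurve (hf : IntervalIntegrable (f G) volume 0 H) :
    AbsolutelyContinuousOnInterval (revenueCurve H f G) 0 H := by
  have hc : AbsolutelyContinuousOnInterval (fun v : ℝ => v) 0 H :=
    (contDiff_id.contDiffOn).absolutelyContinuousOnInterval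
  exact hc.mul (absolutelyContinuous_massAbove hf)

theorem continuousOn_revenueCurve (hH : 0 ≤ H) (hf : IntervalIntegrable (f G) volume 0 H) :
    ContinuousOn (revenueCurve H f G) (Icc 0 H) := by
  simpa [uIcc_of_le hH] using (absolutelyContinuous_revenueCurve hf).continuousOn

theorem ae_hasDerivAt_massAbove (hH : 0 ≤ H) (hf : IntervalIntegrable (f G) volume 0 H) :
    ∀ᵐ v, v ∈ Icc 0 H → HasDerivAt (massAbove H f G) (-f G v) v := by
  filter_upwards [hf.ae_hasDerivAt_integral] with v hv hm
  exact (hv (by simpa [uIcc_of_le hH] using hm) 0 (by simp)).const_sub _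

theorem revenueCurve_nonneg (hf0 : ∀ v ∈ Icc (0 : ℝ) H, 0 ≤ f G v)
    (hf : IntervalIntegrable (f G) volume 0 H) {v : ℝ} (hv : v ∈ Icc 0 H) :
    0 ≤ revenueCurve H f G v :=
  mul_nonneg hv.1 (massAbove_nonneg hf0 hf hv)

theorem revenueCurve_right : revenueCurve H f G H = 0 := by
  rw [revenueCurve_eq, massAbove_right, mul_zero]

end Curves

/-! ### Revenue bound for a single interest. -/

section Utility

variable {H : ℝ} {f : ι → ℝ → ℝ} {G : ι} {x u : ℝ → ℝ}

/-- `u` is a truthful utility with subgradients `x`, the probabilities of being served. -/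
structure IsUtilityCurve (H : ℝ) (x u : ℝ → ℝ) : Prop where
  nonneg : ∀ v ∈ Icc (0 : ℝ) H, 0 ≤ x v
  le_one : ∀ v ∈ Icc (0 : ℝ) H, x v ≤ 1
  subgradient : ∀ v ∈ Icc (0 : ℝ) H, ∀ w ∈ Icc (0 : ℝ) H, u v + x v * (w - v) ≤ u w

theorem IsUtilityCurve.absolutelyContinuous (hH : 0 ≤ H) (h : IsUtilityCurve H x u) :
    AbsolutelyContinuousOnInterval u 0 H := by
  apply LipschitzOnWith.absolutelyContinuousOnInterval (K := 1)
  rw [uIcc_of_le hH]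
  refine LipschitzOnWith.of_le_add_mul 1 fun v hv w hw => ?_
  have h1 := h.subgradient v hv w hw
  have h2 := h.nonneg v hv
  have h3 := h.le_one v hv
  have h4 : x v * (v - w) ≤ dist v w := by
    rw [Real.dist_eq]
    calc x v * (v - w) ≤ x v * |v - w| := by gcongr; exact le_abs_self _
      _ ≤ 1 * |v - w| := by gcongr
      _ = _ := one_mul _
  simp only [NNReal.coe_one, one_mul]
  nlinarith

/-- At an interior point of differentiability, `u` minus its supporting line has a local minimum, so
the slopes agree. -/
theorem IsUtilityCurve.ae_hasDerivAt (hH : 0 ≤ H) (h : IsUtilityCurve H x u) :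
    ∀ᵐ v, v ∈ Icc 0 H → HasDerivAt u (x v) v := by
  have hne : ∀ c : ℝ, ∀ᵐ v : ℝ, v ≠ c := fun c => by simp [ae_iff, measure_singleton]
  filter_upwards [(h.absolutelyContinuous hH).ae_differentiableAt, hne 0, hne H]
    with v hd h0 h1 hv
  have hd := (hd (by rwa [uIcc_of_le hH])).hasDerivAt
  have hmin : IsLocalMin (fun w => u w - x v * (w - v)) v := by
    filter_upwards [Icc_mem_nhds (lt_of_le_of_ne hv.1 h0.symm) (lt_of_le_of_ne hv.2 h1)]
      with w hw
    have := h.subgradient v hv w hw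
    simp only [sub_self, mul_zero, sub_zero]
    linarith
  have hz := hmin.hasDerivAt_eq_zero
    (hd.sub (((hasDerivAt_id v).sub_const v).const_mul (x v)))
  have : deriv u v = x v := by linarith
  rwa [this] at hd

/-- Measurability of `x` is not assumed; it follows because `x` agrees almost everywhere with `deriv
u`. -/
theorem IsUtilityCurve.intervalIntegrable_revenue (hH : 0 ≤ H) (h : IsUtilityCurve H x u)
    (hf : IntervalIntegrable (f G) volume 0 H) :
    IntervalIntegrable (fun v => f G v * (v * x v - u v)) volume 0 H := by
  have hu := h.absolutelyContinuous hH
  have hx : ∀ᵐ v ∂volume.restrict (uIoc 0 H), deriv u v = x v := by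
    rw [ae_restrict_iff' measurableSet_uIoc]
    filter_upwards [h.ae_hasDerivAt hH] with v hv hm
    exact (hv (by rw [uIoc_of_le hH] at hm; exact Ioc_subset_Icc_self hm)).deriv
  have hm : AEStronglyMeasurable x (volume.restrict (uIoc 0 H)) :=
    (hu.intervalIntegrable_deriv.def'.aestronglyMeasurable).congr hx
  have h1 : IntervalIntegrable (fun v => f G v * x v) volume 0 H := by
    rw [intervalIntegrable_iff] at hf ⊢
    refine hf.mul_bdd (c := 1) hm ?_
    rw [ae_restrict_iff' measurableSet_uIoc]
    refine Filter.Eventually.of_forall fun v hv => ?_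
    rw [uIoc_of_le hH] at hv
    have hv := Ioc_subset_Icc_self hv
    rw [Real.norm_eq_abs, abs_of_nonneg (h.nonneg v hv)]
    exact h.le_one v hv
  refine ((h1.mul_continuousOn continuousOn_id).sub
    (hf.mul_continuousOn hu.continuousOn)).congr fun v _ => ?_
  simp only [id]
  ring

/-- Comparison of the revenue from values in `[a, b]` with the revenue of serving all these values
with probability `c`, at a shadow price `Λ` for utility. -/
theorem IsUtilityCurve.integral_le (hH : 0 ≤ H) (h : IsUtilityCurve H x u)
    (hf : IntervalIntegrable (f G) volume 0 H) {a b c Λ : ℝ} (ha : 0 ≤ a) (hab : a ≤ b)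
    (hb : b ≤ H)
    (hc : ∀ v ∈ Ioo a b, ∀ d, HasDerivAt (revenueCurve H f G) d v → (-d - Λ) * (x v - c) ≤ 0) :
    ∫ v in a..b, f G v * (v * x v - u v) ≤
      (massAbove H f G b * u b - massAbove H f G a * u a)
        - c * (revenueCurve H f G b - revenueCurve H f G a) + Λ * (u b - u a - c * (b - a)) := by
  have hsub : uIcc a b ⊆ uIcc 0 H := by grind [uIcc_of_le]
  have hS := (absolutelyContinuous_massAbove (f := f) (G := G) hf).mono hsub
  have hR := (absolutelyContinuous_revenueCurve (f := f) (G := G) hf).mono hsub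
  have hu := (h.absolutelyContinuous hH).mono hsub
  have hSu := hS.fun_mul hu
  have iSu := hSu.intervalIntegrable_deriv
  have iR := hR.intervalIntegrable_deriv.const_mul c
  have iu := (hu.intervalIntegrable_deriv.sub (intervalIntegrable_const (c := c))).const_mul Λ
  -- With `S = massAbove`, the integrand equals `(S u)' - x R'` almost everywhere, and `-x R' = -c
  -- R' + Λ (x - c) + (-R' - Λ)(x - c)`, whose last term is nonpositive by `hc`.
  have key : ∫ v in a..b, f G v * (v * x v - u v) ≤
      ∫ v in a..b, (deriv (fun w => massAbove H f G w * u w) v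
        - c * deriv (revenueCurve H f G) v + Λ * (deriv u v - c)) := by
    refine intervalIntegral.integral_mono_ae_restrict hab
      ((h.intervalIntegrable_revenue hH hf).mono_set hsub) ((iSu.sub iR).add iu) ?_
    have hne : ∀ c : ℝ, ∀ᵐ v : ℝ, v ≠ c := fun c => by simp [ae_iff, measure_singleton]
    rw [Filter.EventuallyLE, ae_restrict_iff' measurableSet_Icc]
    filter_upwards [h.ae_hasDerivAt hH, ae_hasDerivAt_massAbove hH hf, hne a, hne b]
      with v hu hS hva hvb hv
    have hv' : v ∈ Icc 0 H := ⟨ha.trans hv.1, hv.2.trans hb⟩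
    have hu := hu hv'
    have hS := hS hv'
    have hR : HasDerivAt (revenueCurve H f G) (1 * massAbove H f G v + v * -f G v) v :=
      (hasDerivAt_id v).mul hS
    have := hc v ⟨lt_of_le_of_ne hv.1 hva.symm, lt_of_le_of_ne hv.2 hvb⟩ _ hR
    rw [(hS.fun_mul hu).deriv, hR.deriv, hu.deriv]
    nlinarith
  refine key.trans_eq ?_
  rw [intervalIntegral.integral_add (iSu.sub iR) iu, intervalIntegral.integral_sub iSu iR,
    intervalIntegral.integral_const_mul, intervalIntegral.integral_const_mul,
    intervalIntegral.integral_sub hu.intervalIntegrable_deriv intervalIntegrable_const,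
    hSu.integral_deriv_eq_sub, hR.integral_deriv_eq_sub, hu.integral_deriv_eq_sub]
  simp only [intervalIntegral.integral_const, smul_eq_mul]
  ring

/-- A price `p` that maximizes the revenue curve tilted by `Λ` bounds the revenue of every
utility curve, up to the difference of the average prices valued at `Λ`. -/
theorem IsUtilityCurve.revenue_le (h : IsUtilityCurve H x u)
    (hf0 : ∀ v ∈ Icc (0 : ℝ) H, 0 ≤ f G v)
    (hf : IntervalIntegrable (f G) volume 0 H) (hR : DMR H f G) (hu0 : 0 ≤ u 0) {p Λ : ℝ}
    (hp : p ∈ Icc 0 H)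
    (hmax : ∀ v ∈ Icc 0 H, revenueCurve H f G v + Λ * v ≤ revenueCurve H f G p + Λ * p) :
    ∫ v in (0 : ℝ)..H, f G v * (v * x v - u v) ≤
      revenueCurve H f G p + Λ * (p - (H - (u H - u 0))) := by
  have hH : 0 ≤ H := hp.1.trans hp.2
  have i := h.intervalIntegrable_revenue hH hf
  rw [← intervalIntegral.integral_add_adjacent_intervals (b := p)
    (i.mono_set (by grind [uIcc_of_le])) (i.mono_set (by grind [uIcc_of_le]))]
  -- Concavity gives `R' ≥ -Λ` below the maximizer `p` and `R' ≤ -Λ` above it, so the comparison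
  -- serves nobody below `p` (`c = 0`) and everybody above (`c = 1`).
  have h1 := h.integral_le hH hf (a := 0) (b := p) (c := 0) (Λ := Λ) le_rfl hp.1 hp.2 (by
    intro v hv d hd
    have hv' : v ∈ Icc 0 H := ⟨hv.1.le, hv.2.le.trans hp.2⟩
    have hs := hR.slope_le_of_hasDerivAt hv' hp hv.2 hd
    rw [slope_def_field, div_le_iff₀ (by linarith [hv.2])] at hs
    have hm := hmax v hv'
    have : -Λ ≤ d := by
      by_contra! hlt
      nlinarith [hv.2]
    nlinarith [h.nonneg v hv'])
  have h2 := h.integral_le hH hf (a := p) (b := H) (c := 1) (Λ := Λ) hp.1 hp.2 le_rfl (by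
    intro v hv d hd
    have hv' : v ∈ Icc 0 H := ⟨hp.1.trans hv.1.le, hv.2.le⟩
    have hs := hR.le_slope_of_hasDerivAt hp hv' hv.1 hd
    rw [slope_def_field, le_div_iff₀ (by linarith [hv.1])] at hs
    have hm := hmax v hv'
    have : d ≤ -Λ := by
      by_contra! hlt
      nlinarith [hv.1]
    nlinarith [h.le_one v hv'])
  have h3 : 0 ≤ massAbove H f G 0 * u 0 :=
    mul_nonneg (massAbove_nonneg hf0 hf ⟨le_rfl, hH⟩) hu0
  rw [massAbove_right, revenueCurve_right] at h2
  linarith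

end Utility

/-! ### Optimal monotone prices and their Lagrange multipliers. -/

section ConcaveProgram

variable [Fintype ι] {H : ℝ} {R : ι → ℝ → ℝ}

/-- A concave curve that is nonnegative and vanishes at `H` decreases from some point below `H`. -/
theorem exists_antitoneOn_of_concaveOn {g : ℝ → ℝ} (hH : 0 < H) (hg : ConcaveOn ℝ (Icc 0 H) g)
    (hcont : ContinuousOn g (Icc 0 H)) (h0 : ∀ v ∈ Icc 0 H, 0 ≤ g v) (hgH : g H = 0) :
    ∃ m ∈ Ico 0 H, AntitoneOn g (Icc m H) := by
  obtain ⟨m, hm, hmax⟩ := isCompact_Icc.exists_isMaxOn (nonempty_Icc.2 hH.le) hcont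
  have hmax : ∀ v ∈ Icc 0 H, g v ≤ g m := fun v hv => hmax hv
  rcases hm.2.lt_or_eq with hlt | rfl
  · refine ⟨m, ⟨hm.1, hlt⟩, fun a ha b hb hab => ?_⟩
    have hb' : b ∈ Icc 0 H := ⟨hm.1.trans hb.1, hb.2⟩
    have ha' : a ∈ Icc 0 H := ⟨hm.1.trans ha.1, ha.2⟩
    rcases ha.1.eq_or_lt with rfl | hma
    · exact hmax b hb'
    · rcases hab.eq_or_lt with rfl | hab
      · exact le_rfl
      · exact hg.right_le_of_le_left'' hm hb' hma hab.le (hmax a ha')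
  -- A maximum at the right end forces the curve to vanish identically.
  · refine ⟨0, ⟨le_rfl, hH⟩, fun a ha b hb _ => ?_⟩
    exact (hmax b hb).trans (hgH.le.trans (h0 a ha))

theorem exists_forall_antitoneOn [Nonempty ι] (hH : 0 < H)
    (hR : ∀ G, ConcaveOn ℝ (Icc 0 H) (R G)) (hcont : ∀ G, ContinuousOn (R G) (Icc 0 H))
    (h0 : ∀ G, ∀ v ∈ Icc 0 H, 0 ≤ R G v) (hRH : ∀ G, R G H = 0) :
    ∃ m ∈ Ico 0 H, ∀ G, AntitoneOn (R G) (Icc m H) := by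
  choose m hm hanti using fun G =>
    exists_antitoneOn_of_concaveOn hH (hR G) (hcont G) (h0 G) (hRH G)
  have hle : ∀ G, m G ≤ Finset.univ.sup' Finset.univ_nonempty m :=
    fun G => Finset.le_sup' m (Finset.mem_univ G)
  refine ⟨Finset.univ.sup' Finset.univ_nonempty m,
    ⟨(hm (Classical.arbitrary ι)).1.trans (hle _), ?_⟩,
    fun G => (hanti G).mono (Icc_subset_Icc_left (hle G))⟩
  exact (Finset.sup'_lt_iff _).2 fun G _ => (hm G).2

/-- The weight flowing into `G` minus the weight flowing out of `G`. -/
def netInflow (l : ι × ι → ℝ) (G : ι) : ℝ := ∑ G', l (G', G) - ∑ G', l (G, G')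

theorem sum_netInflow_mul (l : ι × ι → ℝ) (p : ι → ℝ) :
    ∑ G, netInflow l G * p G = ∑ e : ι × ι, l e * (p e.2 - p e.1) := by
  simp only [netInflow, mul_sub, sub_mul, Finset.sum_sub_distrib, Finset.sum_mul]
  rw [Fintype.sum_prod_type_right, Fintype.sum_prod_type]

variable [PartialOrder ι]

/-- Prices in `[0, m]` that are best among all monotone prices in `[0, H]`. -/
theorem exists_optimal_monotone_prices {m : ℝ} (hm : m ∈ Icc 0 H)
    (hcont : ∀ G, ContinuousOn (R G) (Icc 0 H)) (hanti : ∀ G, AntitoneOn (R G) (Icc m H)) :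
    ∃ p : ι → ℝ, (∀ G, p G ∈ Icc 0 m) ∧ Monotone p ∧
      ∀ p' : ι → ℝ, (∀ G, p' G ∈ Icc 0 H) → Monotone p' → ∑ G, R G (p' G) ≤ ∑ G, R G (p G) := by
  have hK : IsCompact ((Set.univ.pi fun _ : ι => Icc (0 : ℝ) m) ∩ {p | Monotone p}) := by
    refine (isCompact_univ_pi fun _ => isCompact_Icc).inter_right ?_
    simp only [Monotone, ofPred_forall]
    exact isClosed_iInter fun a => isClosed_iInter fun b => isClosed_iInter fun _ =>
      isClosed_le (continuous_apply a) (continuous_apply b)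
  have hne : ((Set.univ.pi fun _ : ι => Icc (0 : ℝ) m) ∩ {p | Monotone p}).Nonempty :=
    ⟨fun _ => 0, fun _ _ => ⟨le_rfl, hm.1⟩, monotone_const⟩
  have hc : ContinuousOn (fun p : ι → ℝ => ∑ G, R G (p G))
      ((Set.univ.pi fun _ : ι => Icc (0 : ℝ) m) ∩ {p | Monotone p}) := by
    refine continuousOn_finsetSum _ fun G _ => ?_
    refine (hcont G).comp (continuous_apply G).continuousOn fun p hp => ?_
    exact Icc_subset_Icc_right hm.2 (hp.1 G trivial)
  obtain ⟨p, hp, hmax⟩ := hK.exists_isMaxOn hne hc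
  refine ⟨p, fun G => hp.1 G trivial, hp.2, fun p' hp' hmono => ?_⟩
  -- Truncating prices at `m` preserves monotonicity and loses no revenue, as the curves decrease
  -- beyond `m`.
  refine le_trans (Finset.sum_le_sum fun G _ => ?_)
    (hmax (a := fun G => min (p' G) m)
      ⟨fun G _ => ⟨le_min (hp' G).1 hm.1, min_le_right _ _⟩, hmono.min monotone_const⟩)
  beta_reduce
  rcases le_total (p' G) m with h | h
  · rw [min_eq_left h]
  · rw [min_eq_right h]
    exact hanti G ⟨le_rfl, hm.2⟩ ⟨h, (hp' G).2⟩ h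

theorem monotone_of_forall_covBy {p : ι → ℝ} (h : ∀ G G', G ⋖ G' → p G ≤ p G') : Monotone p := by
  classical
  let _ : LocallyFiniteOrder ι := Fintype.toLocallyFiniteOrder
  exact (monotone_iff_forall_covBy p).2 fun a b hab => h a b hab

/-- A Slater point for the monotonicity constraints, obtained by scaling the number of items below
`G`. -/
theorem exists_strictMono_prices (hH : 0 < H) :
    ∃ p : ι → ℝ, (∀ G, p G ∈ Icc 0 H) ∧ StrictMono p := by
  classical
  let k : ι → ℕ := fun G => (Finset.univ.filter (· ≤ G)).card
  have hk : ∀ G, k G ≤ Fintype.card ι := fun G => Finset.card_le_univ _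
  have hks : StrictMono k := fun G G' h => by
    refine Finset.card_lt_card ((Finset.ssubset_iff_of_subset ?_).2 ⟨G', by simp, by simp [h.not_ge]⟩)
    intro K hK
    simp only [Finset.mem_filter, Finset.mem_univ, true_and] at hK ⊢
    exact hK.trans h.le
  have hd : (0 : ℝ) < Fintype.card ι + 1 := by positivity
  refine ⟨fun G => H * (k G / (Fintype.card ι + 1)), fun G => ⟨by positivity, ?_⟩, ?_⟩
  · have : (k G : ℝ) ≤ Fintype.card ι := by exact_mod_cast hk G
    have : (k G : ℝ) / (Fintype.card ι + 1) ≤ 1 := by rw [div_le_one hd]; linarith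
    nlinarith
  · intro G G' h
    have : (k G : ℝ) < k G' := by exact_mod_cast hks h
    beta_reduce
    gcongr

/-- Perturbations of the monotonicity constraints and of the objective that can be met with slack
by prices in `[0, H]`. -/
def slackSet (H : ℝ) (R : ι → ℝ → ℝ) (V : ℝ) : Set ((ι × ι → ℝ) × ℝ) :=
  {q | ∃ p : ι → ℝ, (∀ G, p G ∈ Icc 0 H) ∧
    (∀ e : ι × ι, e.1 ⋖ e.2 → q.1 e < p e.2 - p e.1) ∧ q.2 < ∑ G, R G (p G) - V}

theorem isOpen_slackSet (V : ℝ) : IsOpen (slackSet H R V) := by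
  have : slackSet H R V = ⋃ p ∈ {p : ι → ℝ | ∀ G, p G ∈ Icc 0 H},
      (⋂ e : ι × ι, ⋂ _ : e.1 ⋖ e.2, {q : (ι × ι → ℝ) × ℝ | q.1 e < p e.2 - p e.1}) ∩
        {q | q.2 < ∑ G, R G (p G) - V} := by
    ext q
    simp [slackSet, and_left_comm]
  rw [this]
  refine isOpen_biUnion fun p _ => IsOpen.inter ?_ (isOpen_lt continuous_snd continuous_const)
  exact isOpen_iInter_of_finite fun e => isOpen_iInter_of_finite fun _ =>
    isOpen_lt ((continuous_apply e).comp continuous_fst) continuous_const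

theorem convex_slackSet (hR : ∀ G, ConcaveOn ℝ (Icc 0 H) (R G)) (V : ℝ) :
    Convex ℝ (slackSet H R V) := by
  rw [convex_iff_forall_pos]
  rintro q ⟨p, hp, hpe, hps⟩ q' ⟨p', hp', hpe', hps'⟩ a b ha hb hab
  refine ⟨fun G => a * p G + b * p' G, fun G => ?_, fun e he => ?_, ?_⟩
  · exact convex_Icc 0 H (hp G) (hp' G) ha.le hb.le hab
  · have h1 := mul_lt_mul_of_pos_left (hpe e he) ha
    have h2 := mul_lt_mul_of_pos_left (hpe' e he) hb
    simp only [Prod.fst_add, Prod.smul_fst, Pi.add_apply, Pi.smul_apply, smul_eq_mul]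
    linarith
  · have h1 := mul_lt_mul_of_pos_left hps ha
    have h2 := mul_lt_mul_of_pos_left hps' hb
    have h3 : a * ∑ G, R G (p G) + b * ∑ G, R G (p' G) ≤ ∑ G, R G (a * p G + b * p' G) := by
      rw [Finset.mul_sum, Finset.mul_sum, ← Finset.sum_add_distrib]
      exact Finset.sum_le_sum fun G _ => (hR G).2 (hp G) (hp' G) ha.le hb.le hab
    have h4 : V = a * V + b * V := by rw [← add_mul, hab, one_mul]
    simp only [Prod.snd_add, Prod.smul_snd, smul_eq_mul]
    linarith

/-- Lagrange multipliers for the monotonicity constraints along covering pairs. -/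
theorem exists_multipliers (hH : 0 < H) (hR : ∀ G, ConcaveOn ℝ (Icc 0 H) (R G)) (V : ℝ)
    (hopt : ∀ p : ι → ℝ, (∀ G, p G ∈ Icc 0 H) → Monotone p → ∑ G, R G (p G) ≤ V) :
    ∃ l : ι × ι → ℝ, (∀ e, 0 ≤ l e) ∧ (∀ e : ι × ι, ¬ e.1 ⋖ e.2 → l e = 0) ∧
      ∀ p : ι → ℝ, (∀ G, p G ∈ Icc 0 H) →
        ∑ G, R G (p G) + ∑ e : ι × ι, l e * (p e.2 - p e.1) ≤ V := by
  classical
  have h0 : (0 : (ι × ι → ℝ) × ℝ) ∉ slackSet H R V := by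
    rintro ⟨p, hp, hpe, hps⟩
    have := hopt p hp (monotone_of_forall_covBy fun G G' h => by
      have := hpe (G, G') h
      simp only [Prod.fst_zero, Pi.zero_apply] at this
      linarith)
    simp only [Prod.snd_zero] at hps
    linarith
  -- The separating functional is negative on the slack set; its coordinates, divided by that of the
  -- objective, are the multipliers.
  obtain ⟨φ, hφ⟩ := geometric_hahn_banach_open_point (convex_slackSet hR V)
    (isOpen_slackSet V) h0
  simp only [map_zero] at hφ
  let μ : ι × ι → ℝ := fun e => φ (Pi.single e 1, 0)
  let ν : ℝ := φ (0, 1)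
  have hφeq : ∀ z s, φ (z, s) = ∑ e, z e * μ e + s * ν := by
    intro z s
    have h1 : (z, s) = ∑ e, z e • ((Pi.single e 1 : ι × ι → ℝ), (0 : ℝ)) + s • (0, 1) := by
      ext e
      · simp [Prod.fst_sum, Finset.sum_apply, Pi.single_apply]
      · simp [Prod.snd_sum]
    rw [h1, map_add, map_sum, map_smul]
    simp only [map_smul, smul_eq_mul]
    rfl
  obtain ⟨p₀, hp₀, hstrict⟩ := exists_strictMono_prices (ι := ι) hH
  let s₀ : ℝ := ∑ G, R G (p₀ G) - V - 1
  have hs₀ : s₀ < 0 := by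
    have := hopt p₀ hp₀ hstrict.monotone
    simp only [s₀]
    linarith
  have hmem : ∀ z : ι × ι → ℝ, (∀ e : ι × ι, e.1 ⋖ e.2 → z e ≤ 0) → (z, s₀) ∈ slackSet H R V := by
    intro z hz
    refine ⟨p₀, hp₀, fun e he => ?_, by simp [s₀]⟩
    have := hstrict he.lt
    have := hz e he
    simp only
    linarith
  -- The Slater point excludes a functional that ignores the objective.
  have hν : 0 < ν := by
    have := hφ _ (hmem 0 fun _ _ => le_rfl)
    rw [hφeq] at this
    simp only [Pi.zero_apply, zero_mul, Finset.sum_const_zero, zero_add] at this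
    exact pos_of_mul_neg_right this hs₀.le
  have hline : ∀ (e : ι × ι) (t : ℝ), (e.1 ⋖ e.2 → t ≤ 0) → t * μ e + s₀ * ν < 0 := by
    intro e t ht
    have := hφ _ (hmem (Pi.single e t) fun e' he' => by
      by_cases h : e' = e
      · subst h; simpa using ht he'
      · simp [h])
    rw [hφeq] at this
    simpa [Pi.single_apply] using this
  -- This value of `t` would turn `hline` into `0 < 0`. Coordinates of covering pairs may be
  -- arbitrarily negative, so `μ e ≥ 0`; those of other pairs are free, so `μ e = 0`.
  have hzero : ∀ e, μ e ≠ 0 → ¬ (e.1 ⋖ e.2 → -(s₀ * ν) / μ e ≤ 0) := fun e he ht => by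
    have := hline e _ ht
    rw [div_mul_cancel₀ _ he] at this
    linarith
  have hsν : s₀ * ν < 0 := mul_neg_of_neg_of_pos hs₀ hν
  refine ⟨fun e => μ e / ν, fun e => div_nonneg ?_ hν.le, fun e he => ?_, fun p hp => ?_⟩
  · by_contra! hneg
    exact hzero e hneg.ne fun _ => (div_neg_of_pos_of_neg (by linarith) hneg).le
  · by_cases h : μ e = 0
    · simp [h]
    · exact (hzero e h fun h => absurd h he).elim
  -- Lowering every coordinate by `δ` makes the constraints strict; small `δ` then gives the weak
  -- inequality.
  · have hδ : ∀ δ : ℝ, 0 < δ → φ (fun e => p e.2 - p e.1, ∑ G, R G (p G) - V) ≤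
        δ * φ (fun _ => 1, 1) := by
      intro δ hδ
      have := hφ ((fun e => p e.2 - p e.1, ∑ G, R G (p G) - V) - δ • (fun _ => 1, 1))
        ⟨p, hp, fun e _ => by simpa using hδ, by simpa using hδ⟩
      rw [map_sub, map_smul, smul_eq_mul] at this
      linarith
    have hle : φ (fun e => p e.2 - p e.1, ∑ G, R G (p G) - V) ≤ 0 := by
      by_contra! hpos
      have h1 := hδ 1 one_pos
      have hC : 0 < φ (fun _ => 1, 1) := by linarith
      have h2 := hδ (φ (fun e => p e.2 - p e.1, ∑ G, R G (p G) - V) / (2 * φ (fun _ => 1, 1)))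
        (by positivity)
      field_simp at h2
      linarith
    rw [hφeq] at hle
    have : ∑ e : ι × ι, μ e / ν * (p e.2 - p e.1) =
        (∑ e : ι × ι, (p e.2 - p e.1) * μ e) / ν := by
      rw [Finset.sum_div]
      exact Finset.sum_congr rfl fun e _ => by ring
    have h3 : (∑ e : ι × ι, (p e.2 - p e.1) * μ e) / ν ≤ V - ∑ G, R G (p G) := by
      rw [div_le_iff₀ hν]
      linarith
    rw [this]
    linarith

/-- Prices at which the multipliers certify optimality: complementary slackness holds, and every
price maximizes its own revenue curve tilted by the net inflow of multipliers. -/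
theorem exists_optimal_prices_and_multipliers [Nonempty ι] (hH : 0 < H)
    (hR : ∀ G, ConcaveOn ℝ (Icc 0 H) (R G)) (hcont : ∀ G, ContinuousOn (R G) (Icc 0 H))
    (h0 : ∀ G, ∀ v ∈ Icc 0 H, 0 ≤ R G v) (hRH : ∀ G, R G H = 0) :
    ∃ m ∈ Ico 0 H, (∀ G, AntitoneOn (R G) (Icc m H)) ∧
      ∃ p : ι → ℝ, (∀ G, p G ∈ Icc 0 m) ∧ Monotone p ∧
      ∃ l : ι × ι → ℝ, (∀ e, 0 ≤ l e) ∧ (∀ e : ι × ι, ¬ e.1 ⋖ e.2 → l e = 0) ∧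
        (∀ e : ι × ι, l e * (p e.2 - p e.1) = 0) ∧
        ∀ G, ∀ v ∈ Icc 0 H,
          R G v + netInflow l G * v ≤ R G (p G) + netInflow l G * p G := by
  classical
  obtain ⟨m, hm, hanti⟩ := exists_forall_antitoneOn hH hR hcont h0 hRH
  obtain ⟨p, hp, hmono, hopt⟩ := exists_optimal_monotone_prices ⟨hm.1, hm.2.le⟩ hcont hanti
  obtain ⟨l, hl, hlc, hlag⟩ := exists_multipliers hH hR _ hopt
  have hpH : ∀ G, p G ∈ Icc 0 H := fun G => Icc_subset_Icc_right hm.2.le (hp G)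
  have hterm : ∀ e ∈ Finset.univ, 0 ≤ l e * (p e.2 - p e.1) := by
    intro e _
    by_cases he : e.1 ⋖ e.2
    · exact mul_nonneg (hl e) (sub_nonneg.2 (hmono he.le))
    · rw [hlc e he, zero_mul]
  have hsum : ∑ e : ι × ι, l e * (p e.2 - p e.1) = 0 :=
    le_antisymm (by linarith [hlag p hpH]) (Finset.sum_nonneg hterm)
  refine ⟨m, hm, hanti, p, hp, hmono, l, hl, hlc,
    fun e => (Finset.sum_eq_zero_iff_of_nonneg hterm).1 hsum e (Finset.mem_univ e),
    fun G v hv => ?_⟩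
  -- The Lagrangian separates over items, so changing one price isolates the term of `G`.
  have h := hlag (Function.update p G v) fun K => by
    by_cases hK : K = G
    · subst hK; simpa using hv
    · simpa [hK] using hpH K
  rw [← sum_netInflow_mul, ← Finset.sum_add_distrib] at h
  rw [← sum_netInflow_mul] at hsum
  have h' : ∑ K, (R K (Function.update p G v K) + netInflow l K * Function.update p G v K) ≤
      ∑ K, (R K (p K) + netInflow l K * p K) := by
    rw [Finset.sum_add_distrib (f := fun K => R K (p K)), hsum, add_zero]
    exact h
  rw [← Finset.add_sum_erase _ _ (Finset.mem_univ G),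
    ← Finset.add_sum_erase Finset.univ (fun K => R K (p K) + netInflow l K * p K)
      (Finset.mem_univ G),
    Finset.sum_congr rfl fun K hK => by
      rw [Function.update_of_ne (Finset.ne_of_mem_erase hK)]] at h'
  simp only [Function.update_self] at h'
  exact le_of_add_le_add_right h'

end ConcaveProgram

/-! ### Realizing the multipliers as a flow. -/

section Flow

variable {H m : ℝ}

/-- The uniform probability density on `[m, H]`. -/
def flowDensity (H m : ℝ) : ℝ → ℝ := (Ioi m).indicator fun _ => (H - m)⁻¹

/-- The flow of total weight `l (G, G')` from `G` to `G'`, spread uniformly over the values in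
`[m, H]`. -/
def uniformFlow (H m : ℝ) (l : ι × ι → ℝ) (G G' : ι) (v : ℝ) : ℝ := l (G, G') * flowDensity H m v

/-- The mass that the uniform density on `[m, H]` has above `w`. -/
def flowTail (H m w : ℝ) : ℝ := ∫ x in w..H, flowDensity H m x

/-- The change of an adjusted curve at `v` per unit of inflow. -/
def flowShift (H m v : ℝ) : ℝ := ∫ w in (0 : ℝ)..v, flowTail H m w

theorem flowDensity_nonneg (hm : m < H) (v : ℝ) : 0 ≤ flowDensity H m v :=
  indicator_nonneg (fun _ _ => inv_nonneg.2 (sub_nonneg.2 hm.le)) v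

theorem intervalIntegrable_flowDensity (a b : ℝ) :
    IntervalIntegrable (flowDensity H m) volume a b := by
  have h : IntervalIntegrable (fun _ : ℝ => (H - m)⁻¹) volume a b := intervalIntegrable_const
  rw [intervalIntegrable_iff] at h ⊢
  exact h.indicator measurableSet_Ioi

theorem flowTail_of_le (hm : m < H) {w : ℝ} (hw : w ≤ m) : flowTail H m w = 1 := by
  have hd := intervalIntegrable_flowDensity (H := H) (m := m)
  rw [flowTail, ← intervalIntegral.integral_add_adjacent_intervals (hd w m) (hd m H)]
  have h1 : ∫ x in w..m, flowDensity H m x = 0 := by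
    refine intervalIntegral.integral_zero_ae (Filter.Eventually.of_forall fun x hx => ?_)
    rw [uIoc_of_le hw] at hx
    simp [flowDensity, hx.2]
  have h2 : ∫ x in m..H, flowDensity H m x = ∫ _ in m..H, (H - m)⁻¹ := by
    refine intervalIntegral.integral_congr_ae (Filter.Eventually.of_forall fun x hx => ?_)
    rw [uIoc_of_le hm.le] at hx
    simp [flowDensity, hx.1]
  rw [h1, h2, intervalIntegral.integral_const, smul_eq_mul, zero_add,
    mul_inv_cancel₀ (sub_pos.2 hm).ne']

theorem flowTail_nonneg (hm : m < H) {w : ℝ} (hw : w ≤ H) : 0 ≤ flowTail H m w :=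
  intervalIntegral.integral_nonneg hw fun x _ => flowDensity_nonneg hm x

theorem antitone_flowTail (hm : m < H) : Antitone (flowTail H m) := by
  intro a b hab
  have hd := intervalIntegrable_flowDensity (H := H) (m := m)
  rw [flowTail, flowTail, ← intervalIntegral.integral_add_adjacent_intervals (hd a b) (hd b H)]
  have := intervalIntegral.integral_nonneg (μ := volume) hab
    fun x _ => flowDensity_nonneg (H := H) hm x
  linarith

theorem flowTail_le_one (hm : m < H) (w : ℝ) : flowTail H m w ≤ 1 := by
  rcases le_total w m with h | h
  · exact (flowTail_of_le hm h).le
  · exact (antitone_flowTail hm h).trans (flowTail_of_le hm le_rfl).le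

theorem intervalIntegrable_flowTail (hm : m < H) (a b : ℝ) :
    IntervalIntegrable (flowTail H m) volume a b :=
  (antitone_flowTail hm).intervalIntegrable

theorem flowShift_of_le (hm : m < H) {v : ℝ} (hv : v ∈ Icc 0 m) : flowShift H m v = v := by
  rw [flowShift, intervalIntegral.integral_congr (g := fun _ => 1)]
  · simp
  · intro w hw
    rw [uIcc_of_le hv.1] at hw
    exact flowTail_of_le hm (hw.2.trans hv.2)

theorem flowShift_le (hm : m < H) {v : ℝ} (hv : 0 ≤ v) : flowShift H m v ≤ v := by
  have := intervalIntegral.integral_mono_on hv (intervalIntegrable_flowTail hm 0 v)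
    intervalIntegrable_const (fun w _ => flowTail_le_one hm w)
  simpa [flowShift] using this

theorem monotoneOn_flowShift (hm : m < H) : MonotoneOn (flowShift H m) (Icc 0 H) := by
  intro a ha b hb hab
  rw [flowShift, flowShift, ← intervalIntegral.integral_add_adjacent_intervals
    (intervalIntegrable_flowTail hm 0 a) (intervalIntegrable_flowTail hm a b)]
  have := intervalIntegral.integral_nonneg (μ := volume) hab
    fun w hw => flowTail_nonneg hm (hw.2.trans hb.2)
  linarith

variable [PartialOrder ι] {l : ι × ι → ℝ}

theorem isFlow_uniformFlow (hm : m < H) (hl : ∀ e, 0 ≤ l e) : IsFlow H (uniformFlow H m l) :=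
  fun _ _ _ => ⟨(intervalIntegrable_flowDensity 0 H).const_mul _,
    fun v _ => mul_nonneg (hl _) (flowDensity_nonneg hm v)⟩

/-- All pairs share one density, so only the net inflow matters. -/
theorem adjustedCurve_uniformFlow [Fintype ι] (f : ι → ℝ → ℝ)
    (hlc : ∀ e : ι × ι, ¬ e.1 ⋖ e.2 → l e = 0) (G : ι) (v : ℝ) :
    adjustedCurve H f (uniformFlow H m l) G v =
      revenueCurve H f G v + netInflow l G * flowShift H m v := by
  classical
  rw [adjustedCurve, flowShift, ← intervalIntegral.integral_const_mul]
  congr 2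
  ext w
  have hint : ∀ K K', ∫ x in w..H, uniformFlow H m l K K' x = l (K, K') * flowTail H m w :=
    fun K K' => intervalIntegral.integral_const_mul _ _
  simp only [hint, netInflow, sub_mul, Finset.sum_mul]
  congr 1
  · refine Finset.sum_subset (Finset.filter_subset _ _) fun K _ hK => ?_
    rw [hlc (K, G) (by simpa using hK), zero_mul]
  · refine Finset.sum_subset (Finset.filter_subset _ _) fun K _ hK => ?_
    rw [hlc (G, K) (by simpa using hK), zero_mul]

/-- For `v ≥ m` and net inflow `Λ ≥ 0`, `flowShift ≤ v` reduces to `hmax`; for `Λ ≤ 0`, both the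
shift term and the revenue curve decrease from `m` on, so `v = m` is at least as good. -/
theorem isMonopolyPrice_adjustedCurve [Fintype ι] {f : ι → ℝ → ℝ}
    (hlc : ∀ e : ι × ι, ¬ e.1 ⋖ e.2 → l e = 0) {G : ι} (hm : m ∈ Ico 0 H)
    (hanti : AntitoneOn (revenueCurve H f G) (Icc m H)) {p : ℝ} (hp : p ∈ Icc 0 m)
    (hmax : ∀ v ∈ Icc 0 H, revenueCurve H f G v + netInflow l G * v ≤
      revenueCurve H f G p + netInflow l G * p) :
    IsMonopolyPrice H (adjustedCurve H f (uniformFlow H m l) G) p := by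
  refine ⟨Icc_subset_Icc_right hm.2.le hp, fun v hv => ?_⟩
  rw [adjustedCurve_uniformFlow f hlc, adjustedCurve_uniformFlow f hlc, flowShift_of_le hm.2 hp]
  rcases le_total v m with hvm | hvm
  · rw [flowShift_of_le hm.2 ⟨hv.1, hvm⟩]
    exact hmax v hv
  rcases le_total 0 (netInflow l G) with hΛ | hΛ
  · have := mul_le_mul_of_nonneg_left (flowShift_le hm.2 hv.1) hΛ
    linarith [hmax v hv]
  · have hmH : m ∈ Icc 0 H := ⟨hm.1, hm.2.le⟩
    have h1 := mul_le_mul_of_nonpos_left (monotoneOn_flowShift hm.2 hmH hv hvm) hΛ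
    rw [flowShift_of_le hm.2 ⟨hm.1, le_rfl⟩] at h1
    have h2 := hanti ⟨le_rfl, hm.2.le⟩ ⟨hvm, hv.2⟩ hvm
    linarith [hmax m hmH]

end Flow

/-! ### Weak duality for mechanisms and the revenue of item pricing. -/

section Mechanisms

variable [PartialOrder ι] {H : ℝ} {f : ι → ℝ → ℝ} {M : Mechanism ι} {p : ι → ℝ}

theorem Mechanism.IsItemPricing.pay_of_lt (hM : M.IsItemPricing H p) (hp : Monotone p)
    (h0 : ∀ G, 0 ≤ p G) {v : ℝ} (hv : v ∈ Icc 0 H) {G : ι} (h : p G < v) : M.pay v G = p G := by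
  obtain ⟨c, hc, -, hpay⟩ := hM v hv G
  have hG := hc (some G)
  cases c with
  | none =>
    simp only [purchaseUtility, le_refl, if_true] at hG
    linarith
  | some K =>
    simp only [purchaseUtility, le_refl, if_true] at hG
    rw [hpay, Option.elim_some]
    split_ifs at hG with hK
    · exact le_antisymm (by linarith) (hp hK)
    · linarith [h0 K]

theorem Mechanism.IsItemPricing.pay_of_gt (hM : M.IsItemPricing H p) (hp : Monotone p)
    (h0 : ∀ G, 0 ≤ p G) {v : ℝ} (hv : v ∈ Icc 0 H) {G : ι} (h : v < p G) : M.pay v G = 0 := by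
  obtain ⟨c, hc, -, hpay⟩ := hM v hv G
  have hn := hc none
  cases c with
  | none => exact hpay
  | some K =>
    simp only [purchaseUtility] at hn
    rw [hpay, Option.elim_some]
    split_ifs at hn with hK
    · linarith [hp hK]
    · exact le_antisymm (by linarith) (h0 K)

variable [Fintype ι]

open Classical in
/-- The probability that a truthful type `(v, G)` gets an item that it values. -/
def Mechanism.service (M : Mechanism ι) (G : ι) (v : ℝ) : ℝ := ∑ K with G ≤ K, M.alloc v G K

theorem Mechanism.utility_self_interest (v w : ℝ) (G : ι) :
    M.utility w G v G = w * M.service G v - M.pay v G := rfl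

theorem Mechanism.IsAdmissible.isUtilityCurve (hM : M.IsAdmissible H) (G : ι) :
    IsUtilityCurve H (M.service G) (fun v => M.utility v G v G) where
  nonneg v hv := Finset.sum_nonneg fun K _ => hM.alloc_nonneg v hv G K
  le_one v hv := by
    classical
    exact (Finset.sum_le_sum_of_subset_of_nonneg (Finset.filter_subset _ _)
      fun K _ _ => hM.alloc_nonneg v hv G K).trans (hM.alloc_sum_le_one v hv G)
  subgradient v hv w hw := by
    have := hM.incentive_compatible w hw G v hv G
    rw [Mechanism.utility_self_interest] at this
    rw [Mechanism.utility_self_interest v v]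
    linarith

/-- At value `0` all interests get the same utility. -/
theorem Mechanism.IsAdmissible.utility_zero_eq (hM : M.IsAdmissible H) (hH : 0 ≤ H) (G G' : ι) :
    M.utility 0 G 0 G = M.utility 0 G' 0 G' := by
  have h1 := hM.incentive_compatible 0 ⟨le_rfl, hH⟩ G 0 ⟨le_rfl, hH⟩ G'
  have h2 := hM.incentive_compatible 0 ⟨le_rfl, hH⟩ G' 0 ⟨le_rfl, hH⟩ G
  simp only [Mechanism.utility, zero_mul] at h1 h2 ⊢
  linarith

/-- Less demanding types get at least the utility of more demanding ones. -/
theorem Mechanism.IsAdmissible.utility_le (hM : M.IsAdmissible H) {v : ℝ} (hv : v ∈ Icc 0 H)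
    {G G' : ι} (h : G ≤ G') : M.utility v G' v G' ≤ M.utility v G v G := by
  classical
  refine le_trans ?_ (hM.incentive_compatible v hv G v hv G')
  refine sub_le_sub_right (mul_le_mul_of_nonneg_left ?_ hv.1) _
  refine Finset.sum_le_sum_of_subset_of_nonneg ?_ fun K _ _ => hM.alloc_nonneg v hv G' K
  intro K hK
  simp only [Finset.mem_filter, Finset.mem_univ, true_and] at hK ⊢
  exact h.trans hK

/-- Weak duality: multipliers bound the revenue of every admissible mechanism. -/
theorem Mechanism.IsAdmissible.revenue_le (hM : M.IsAdmissible H) (hf : IsTypeDensity H f)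
    (hR : ∀ G, DMR H f G) (hp : ∀ G, p G ∈ Icc 0 H) {l : ι × ι → ℝ} (hl : ∀ e, 0 ≤ l e)
    (hlc : ∀ e : ι × ι, ¬ e.1 ⋖ e.2 → l e = 0) (hslack : ∀ e : ι × ι, l e * (p e.2 - p e.1) = 0)
    (hmax : ∀ G, ∀ v ∈ Icc 0 H, revenueCurve H f G v + netInflow l G * v ≤
      revenueCurve H f G (p G) + netInflow l G * p G) :
    M.revenue H f ≤ ∑ G, revenueCurve H f G (p G) := by
  have hH := hf.pos.le
  have h0 : (0 : ℝ) ∈ Icc 0 H := ⟨le_rfl, hH⟩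
  have hHH : H ∈ Icc 0 H := ⟨hH, le_rfl⟩
  let q : ι → ℝ := fun G => H - (M.utility H G H G - M.utility 0 G 0 G)
  have hG : ∀ G, ∫ v in Icc (0 : ℝ) H, f G v * M.pay v G ≤
      revenueCurve H f G (p G) + netInflow l G * (p G - q G) := by
    intro G
    rw [integral_Icc_eq_integral_Ioc, ← intervalIntegral.integral_of_le hH]
    refine le_of_eq_of_le ?_ ((hM.isUtilityCurve G).revenue_le (hf.nonneg G)
      (hf.intervalIntegrable hH G) (hR G) (hM.individually_rational 0 h0 G) (hp G) (hmax G))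
    refine intervalIntegral.integral_congr fun v _ => ?_
    rw [Mechanism.utility_self_interest]
    ring
  refine (Finset.sum_le_sum fun G _ => hG G).trans ?_
  have hpq : ∑ G, netInflow l G * (p G - q G) = -∑ e : ι × ι, l e * (q e.2 - q e.1) := by
    simp only [mul_sub (netInflow l _)]
    rw [Finset.sum_sub_distrib, sum_netInflow_mul, sum_netInflow_mul,
      Finset.sum_eq_zero fun e _ => hslack e, zero_sub]
  -- Equal utilities at value `0` and ordered utilities at `H` make the average prices `q` monotone.
  have hq : 0 ≤ ∑ e : ι × ι, l e * (q e.2 - q e.1) := by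
    refine Finset.sum_nonneg fun e _ => ?_
    by_cases he : e.1 ⋖ e.2
    · refine mul_nonneg (hl e) ?_
      have h1 := hM.utility_zero_eq hH e.1 e.2
      have h2 := hM.utility_le hHH he.le
      simp only [q]
      linarith
    · rw [hlc e he, zero_mul]
  rw [Finset.sum_add_distrib, hpq]
  linarith

theorem Mechanism.utility_eq_purchaseUtility {v v' : ℝ} {G G' : ι} {c : Option ι}
    (ha : ∀ K, M.alloc v' G' K = open Classical in if c = some K then 1 else 0)
    (hp : M.pay v' G' = c.elim 0 p) : M.utility v G v' G' = purchaseUtility p v G c := by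
  classical
  rw [Mechanism.utility, hp]
  simp only [ha]
  cases c with
  | none => simp [purchaseUtility]
  | some K =>
    simp only [Option.some.injEq, Finset.sum_ite_eq, Finset.mem_filter, Finset.mem_univ, true_and,
      purchaseUtility, Option.elim_some, mul_ite, mul_one, mul_zero]

theorem Mechanism.IsItemPricing.isAdmissible (hM : M.IsItemPricing H p) : M.IsAdmissible H where
  alloc_nonneg v hv G K := by
    obtain ⟨c, -, ha, -⟩ := hM v hv G
    rw [ha]
    split_ifs <;> norm_num
  alloc_sum_le_one v hv G := by
    classical
    obtain ⟨c, -, ha, -⟩ := hM v hv G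
    simp only [ha]
    cases c <;> simp
  incentive_compatible v hv G v' hv' G' := by
    obtain ⟨c, hc, ha, hp⟩ := hM v hv G
    obtain ⟨c', -, ha', hp'⟩ := hM v' hv' G'
    rw [Mechanism.utility_eq_purchaseUtility ha hp, Mechanism.utility_eq_purchaseUtility ha' hp']
    exact hc c'
  individually_rational v hv G := by
    obtain ⟨c, hc, ha, hp⟩ := hM v hv G
    rw [Mechanism.utility_eq_purchaseUtility ha hp]
    exact hc none

theorem exists_isItemPricing (H : ℝ) (p : ι → ℝ) : ∃ M : Mechanism ι, M.IsItemPricing H p := by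
  classical
  choose c hc using fun (v : ℝ) (G : ι) => Finite.exists_max (purchaseUtility p v G)
  refine ⟨⟨fun v G K => if c v G = some K then 1 else 0, fun v G => (c v G).elim 0 p⟩,
    fun v _ G => ⟨c v G, hc v G, fun K => ?_, rfl⟩⟩
  congr

/-- Tie-breaking can change the payment for interest `G` only at `v = p G`, a null set. -/
theorem Mechanism.IsItemPricing.revenue_eq (hM : M.IsItemPricing H p) (hf : IsTypeDensity H f)
    (hp : Monotone p) (hpH : ∀ G, p G ∈ Icc 0 H) :
    M.revenue H f = ∑ G, revenueCurve H f G (p G) := by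
  have hH := hf.pos.le
  refine Finset.sum_congr rfl fun G _ => ?_
  have hne : ∀ᵐ v : ℝ, v ≠ p G := by simp [ae_iff, measure_singleton]
  have hfG := hf.intervalIntegrable hH G
  have h0 : ∀ K, 0 ≤ p K := fun K => (hpH K).1
  have hlow : ∀ᵐ v, v ∈ uIoc 0 (p G) → f G v * M.pay v G = 0 := by
    filter_upwards [hne] with v hv hm
    rw [uIoc_of_le (hpH G).1] at hm
    rw [hM.pay_of_gt hp h0 ⟨hm.1.le, hm.2.trans (hpH G).2⟩ (lt_of_le_of_ne hm.2 hv), mul_zero]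
  have hhigh : ∀ v ∈ uIoc (p G) H, f G v * M.pay v G = p G * f G v := by
    intro v hm
    rw [uIoc_of_le (hpH G).2] at hm
    rw [hM.pay_of_lt hp h0 ⟨(hpH G).1.trans hm.1.le, hm.2⟩ hm.1, mul_comm]
  have i1 : IntervalIntegrable (fun v => f G v * M.pay v G) volume 0 (p G) := by
    refine (intervalIntegrable_const (c := (0 : ℝ))).congr_ae ?_
    rw [Filter.EventuallyEq, ae_restrict_iff' measurableSet_uIoc]
    filter_upwards [hlow] with v hv hm
    exact (hv hm).symm
  have i2 : IntervalIntegrable (fun v => f G v * M.pay v G) volume (p G) H :=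
    ((hfG.mono_set (by grind [uIcc_of_le])).const_mul (p G)).congr
      fun v hv => (hhigh v hv).symm
  rw [integral_Icc_eq_integral_Ioc, ← intervalIntegral.integral_of_le hH,
    ← intervalIntegral.integral_add_adjacent_intervals i1 i2,
    intervalIntegral.integral_zero_ae hlow,
    intervalIntegral.integral_congr_ae (Filter.Eventually.of_forall hhigh),
    intervalIntegral.integral_const_mul, ← massAbove_eq_integral hH hfG (hpH G), zero_add,
    revenueCurve_eq]

end Mechanisms

end POPricing

end

theorem mainTheorem3 {ι : Type*} [Fintype ι] [PartialOrder ι] (H : ℝ) (f : ι → ℝ → ℝ)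
    (hf : POPricing.IsTypeDensity H f) (hDMR : ∀ G, POPricing.DMR H f G) :
    ∃ p : ι → ℝ,
      -- a deterministic item pricing is optimal, however the buyer breaks ties
      (∃ M : POPricing.Mechanism ι, M.IsItemPricing H p) ∧
      (∀ M : POPricing.Mechanism ι, M.IsItemPricing H p → M.IsOptimal H f) ∧
      -- the prices come from flow-adjusted monopoly prices by recursion from the best items
      ∃ (α : ι → ι → ℝ → ℝ) (r : ι → ℝ),
        POPricing.IsFlow H α ∧
        (∀ G, POPricing.IsMonopolyPrice H (POPricing.adjustedCurve H f α G) (r G)) ∧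
        POPricing.IsRecursivePrice r p ∧
        (∀ G, POPricing.IsMonopolyPrice H (POPricing.adjustedCurve H f α G) (p G)) ∧
        (∀ G G', G ⋖ G' → ∀ v ∈ Set.Icc (0 : ℝ) H, 0 < α G G' v →
          max (v - p G) 0 = max (v - p G') 0) := by
  have hH := hf.pos
  have hne : Nonempty ι := by
    by_contra h
    rw [not_nonempty_iff] at h
    simpa using hf.total
  have hfi := hf.intervalIntegrable hH.le
  obtain ⟨m, hm, hanti, p, hp, hmono, l, hl, hlc, hslack, hmax⟩ :=
    POPricing.exists_optimal_prices_and_multipliers (R := POPricing.revenueCurve H f) hH hDMR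
      (fun G => POPricing.continuousOn_revenueCurve hH.le (hfi G))
      (fun G _ hv => POPricing.revenueCurve_nonneg (hf.nonneg G) (hfi G) hv)
      (fun G => POPricing.revenueCurve_right)
  have hpH : ∀ G, p G ∈ Icc 0 H := fun G => Icc_subset_Icc_right hm.2.le (hp G)
  have hmonopoly := fun G =>
    POPricing.isMonopolyPrice_adjustedCurve hlc hm (hanti G) (hp G) (hmax G)
  refine ⟨p, POPricing.exists_isItemPricing H p, fun M hM => ⟨hM.isAdmissible, fun M' hM' => ?_⟩,
    POPricing.uniformFlow H m l, p, POPricing.isFlow_uniformFlow hm.2 hl, hmonopoly, fun G => ?_,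
    hmonopoly, fun G G' _ v _ hpos => ?_⟩
  · rw [hM.revenue_eq hf hmono hpH]
    exact hM'.revenue_le hf hDMR hpH hl hlc hslack hmax
  · refine ⟨mem_insert _ _, ?_⟩
    rintro _ (rfl | ⟨G', hG', rfl⟩)
    · exact le_rfl
    · exact hmono (CovBy.le hG')
  -- Positive flow needs a positive multiplier, and complementary slackness then makes the two
  -- prices equal.
  · have hlne : l (G, G') ≠ 0 := fun h => by simp [POPricing.uniformFlow, h] at hpos
    have := (mul_eq_zero.1 (hslack (G, G'))).resolve_left hlne
    rw [sub_eq_zero.1 this]
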